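/- Let $N\ge 1$ and let $\mathcal H=L^2(\mathbb R^N)$ be the Hilbert space of $N$ bosonic modes. For $x=(q_1,p_1,\dots,q_N,p_N)^T\in\mathbb R^{2N}$ let $W(x)=e^{-ix^T\Omega R}$ be the Weyl operator, where $\Omega=\bigoplus_{j=1}^N\begin{pmatrix}0&1\\-1&0\end{pmatrix}$ and $R=(Q_1,P_1,\dots,Q_N,P_N)^T$ is the vector of position and momentum operators; explicitly, $(W(x)\psi)(t)=e^{i(p\cdot t-q\cdot p/2)}\psi(t-q)$ with $q=(q_j)_j$, $p=(p_j)_j$. A state is a positive operator on $\mathcal H$ of trace one. An observable with outcomes in $\mathbb R^M$ is a map $\mathsf E$ from the Borel sets of $\mathbb R^M$ to the bounded positive operators on $\mathcal H$ with $\mathsf E(\mathbb R^M)=I$ that is $\sigma$-additive in the weak operator topology; its outcome distribution in the state $\rho$ is $X\mapsto\mathrm{tr}[\rho\,\mathsf E(X)]$. The observable $\mathsf E$ is Gaussian if there are a real $2N\times M$ matrix $A$, a real $M\times M$ matrix $B$ with $B-iA^T\Omega A\ge 0$, and $v\in\mathbb R^M$ such that $$\int e^{ip^Tx}\,\mathsf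 E(dx)=e^{-\frac14p^TBp-iv^Tp}\,W(Ap)\qquad\text{for all }p\in\mathbb R^M .$$ A family of observables is informationally complete if any two states that have the same outcome distribution for every observable of the family are equal; a single observable is informationally complete if the family consisting of it alone is. Let $(\mathsf E_j)_{j\in I}$ be a family of Gaussian observables on $\mathcal H$, with $\mathsf E_j$ taking values in $\mathbb R^{M_j}$. (i) If $I$ is finite, then $\{\mathsf E_j\mid j\in I\}$ is informationally complete if and only if $\mathsf E_{j_0}$ is informationally complete for some $j_0\in I$. (ii) Consequently, for arbitrary $I$, if $\{\mathsf E_j\mid j\in I\}$ is informationally complete but no single $\mathsf E_j$ is informationally complete, then the set $\{\mathsf E_j\mid j\in I\}$ is infinite. -/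

import Mathlib

open MeasureTheory
open scoped ENNReal ComplexOrder Kronecker

noncomputable section

namespace GaussianObs

/-! ### States and observables on a Hilbert space -/

section Abstract

universe u

variable {H : Type u} [NormedAddCommGroup H] [InnerProductSpace ℂ H]

/-- `T` has trace `t`: in every orthonormal (Hilbert) basis `(b_i)` the series
`∑ ⟨b_i, T b_i⟩` converges to `t`. -/
def HasTrace (T : H →L[ℂ] H) (t : ℂ) : Prop :=
  ∀ (ι : Type u) (b : HilbertBasis ι ℂ H), HasSum (fun i => inner ℂ (b i) (T (b i))) t

open Classical in
/-- The trace of an operator (set to `0` for an operator which has no trace). -/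
def trace (T : H →L[ℂ] H) : ℂ :=
  if h : ∃ t, HasTrace T t then h.choose else 0

/-- A state: a positive operator of trace one. -/
def IsState (ρ : H →L[ℂ] H) : Prop :=
  ρ.IsPositive ∧ HasTrace ρ 1

/-- An observable (normalized positive operator valued measure) on the Borel sets of `ℝ^M`, with
`σ`-additivity in the weak operator topology. As for Mathlib's vector measures, the value on a
set that is not Borel is `0` by convention, so two observables are equal exactly when they agree on
all Borel sets. -/
structure Observable (H : Type u) [NormedAddCommGroup H] [InnerProductSpace ℂ H] (M : ℕ) where
  toFun : Set (EuclideanSpace ℝ (Fin M)) → (H →L[ℂ] H)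
  not_measurable : ∀ X, ¬ MeasurableSet X → toFun X = 0
  positive : ∀ X, MeasurableSet X → (toFun X).IsPositive
  normalized : toFun Set.univ = ContinuousLinearMap.id ℂ H
  sigma_additive : ∀ X : ℕ → Set (EuclideanSpace ℝ (Fin M)), (∀ n, MeasurableSet (X n)) →
    Pairwise (fun m n => Disjoint (X m) (X n)) → ∀ φ ψ : H,
      HasSum (fun n => inner ℂ φ (toFun (X n) ψ)) (inner ℂ φ (toFun (⋃ n, X n) ψ))

namespace Observable

variable {M : ℕ}

theorem toFun_empty_inner (E : Observable H M) (φ ψ : H) :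
    inner ℂ φ (E.toFun ∅ ψ) = 0 := by
  have h := E.sigma_additive (fun _ => ∅) (fun _ => MeasurableSet.empty)
    (fun _ _ _ => disjoint_bot_left) φ ψ
  simpa using tendsto_nhds_unique h.summable.tendsto_atTop_zero tendsto_const_nhds |>.symm

/-- The finite Borel measure `X ↦ ⟨ψ, E(X) ψ⟩` on `ℝ^M`. -/
def vectorMeasure (E : Observable H M) (ψ : H) : Measure (EuclideanSpace ℝ (Fin M)) :=
  Measure.ofMeasurable (fun X _ => ENNReal.ofReal (inner ℂ ψ (E.toFun X ψ)).re)
    (by simp [toFun_empty_inner])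
    (by
      intro X hX hd
      have h := Complex.hasSum_re (E.sigma_additive X hX hd ψ ψ)
      have hn : ∀ n, 0 ≤ (inner ℂ ψ (E.toFun (X n) ψ)).re := fun n =>
        (E.positive _ (hX n)).re_inner_nonneg_right ψ
      rw [← h.tsum_eq, ENNReal.ofReal_tsum_of_nonneg hn h.summable])

theorem vectorMeasure_apply (E : Observable H M) (ψ : H)
    {X : Set (EuclideanSpace ℝ (Fin M))} (hX : MeasurableSet X) :
    E.vectorMeasure ψ X = ENNReal.ofReal (inner ℂ ψ (E.toFun X ψ)).re :=
  Measure.ofMeasurable_apply X hX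

/-- The operator `T` is the value `∫ exp(i pᵀx) E(dx)` of the characteristic function of `E` at
`p`. The integral is understood weakly; an operator on a complex Hilbert space is determined by its
quadratic form. -/
def HasCharFunAt (E : Observable H M) (p : EuclideanSpace ℝ (Fin M)) (T : H →L[ℂ] H) : Prop :=
  ∀ ψ : H, charFun (E.vectorMeasure ψ) p = inner ℂ ψ (T ψ)

/-- The probability `tr[ρ E(X)]` of an outcome in `X` when `E` is measured in the state `ρ`. -/
def prob (E : Observable H M) (ρ : H →L[ℂ] H) (X : Set (EuclideanSpace ℝ (Fin M))) : ℂ :=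
  trace (ρ ∘L E.toFun X)

end Observable

/-- A family of observables is informationally complete if every state is uniquely determined
by the collection of its outcome distributions. -/
def InformationallyComplete {I : Type*} {M : I → ℕ} (E : (j : I) → Observable H (M j)) : Prop :=
  ∀ ρ σ : H →L[ℂ] H, IsState ρ → IsState σ →
    (∀ j, ∀ X, MeasurableSet X → (E j).prob ρ X = (E j).prob σ X) → ρ = σ

end Abstract

/-! ### The Hilbert space of `N` modes and the Weyl operators -/

/-- The Hilbert space `L²(ℝ^N)` of `N` bosonic modes. -/
abbrev ModeSpace (N : ℕ) : Type :=
  Lp ℂ 2 (volume : Measure (EuclideanSpace ℝ (Fin N)))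

/-- The phase space `ℝ^{2N}`; a point `(q_1, p_1, …, q_N, p_N)` is the function with
`x (j, 0) = q_j` and `x (j, 1) = p_j`. -/
abbrev PhaseSpace (N : ℕ) : Type := Fin N × Fin 2 → ℝ

/-- The position coordinates of a phase space point. -/
def PhaseSpace.pos {N : ℕ} (x : PhaseSpace N) : EuclideanSpace ℝ (Fin N) :=
  WithLp.toLp 2 fun j => x (j, 0)

/-- The momentum coordinates of a phase space point. -/
def PhaseSpace.mom {N : ℕ} (x : PhaseSpace N) : EuclideanSpace ℝ (Fin N) :=
  WithLp.toLp 2 fun j => x (j, 1)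

/-- The matrix `Ω = ⨁_j [[0, 1], [-1, 0]]` of the symplectic form. -/
def Omega (N : ℕ) : Matrix (Fin N × Fin 2) (Fin N × Fin 2) ℝ :=
  (1 : Matrix (Fin N) (Fin N) ℝ) ⊗ₖ !![0, 1; -1, 0]

/-- The function `t ↦ exp(i (p·t - q·p/2)) ψ(t - q)`, where `x = (q, p)`. -/
def weylFun {N : ℕ} (x : PhaseSpace N) (ψ : EuclideanSpace ℝ (Fin N) → ℂ) :
    EuclideanSpace ℝ (Fin N) → ℂ := fun t =>
  Complex.exp (Complex.I * ((inner ℝ x.mom t - inner ℝ x.pos x.mom / 2 : ℝ) : ℂ)) * ψ (t - x.pos)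

theorem norm_weylFun {N : ℕ} (x : PhaseSpace N) (ψ : EuclideanSpace ℝ (Fin N) → ℂ)
    (t : EuclideanSpace ℝ (Fin N)) : ‖weylFun x ψ t‖ = ‖ψ (t - x.pos)‖ := by
  rw [weylFun, norm_mul, mul_comm Complex.I, Complex.norm_exp_ofReal_mul_I, one_mul]

theorem aestronglyMeasurable_weylFun {N : ℕ} (x : PhaseSpace N)
    {ψ : EuclideanSpace ℝ (Fin N) → ℂ} (h : AEStronglyMeasurable ψ volume) :
    AEStronglyMeasurable (weylFun x ψ) volume := by
  refine AEStronglyMeasurable.mul (Continuous.aestronglyMeasurable (by fun_prop)) ?_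
  exact h.comp_measurePreserving (measurePreserving_sub_right volume x.pos)

theorem eLpNorm_weylFun {N : ℕ} (x : PhaseSpace N)
    {ψ : EuclideanSpace ℝ (Fin N) → ℂ} (h : AEStronglyMeasurable ψ volume) :
    eLpNorm (weylFun x ψ) 2 volume = eLpNorm ψ 2 volume := by
  rw [← eLpNorm_comp_measurePreserving h (measurePreserving_sub_right volume x.pos)]
  exact eLpNorm_congr_norm_ae (Filter.Eventually.of_forall (norm_weylFun x ψ))

theorem memLp_weylFun {N : ℕ} (x : PhaseSpace N)
    {ψ : EuclideanSpace ℝ (Fin N) → ℂ} (h : MemLp ψ 2 volume) :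
    MemLp (weylFun x ψ) 2 volume :=
  ⟨aestronglyMeasurable_weylFun x h.1, by rw [eLpNorm_weylFun x h.1]; exact h.2⟩

theorem weylFun_congr_ae {N : ℕ} (x : PhaseSpace N)
    {ψ φ : EuclideanSpace ℝ (Fin N) → ℂ} (h : ψ =ᵐ[volume] φ) :
    weylFun x ψ =ᵐ[volume] weylFun x φ := by
  have h' := (measurePreserving_sub_right volume x.pos).quasiMeasurePreserving.ae_eq_comp h
  filter_upwards [h'] with t ht
  simp only [Function.comp_apply] at ht
  simp only [weylFun, ht]

/-- The Weyl operator `W(x) = exp(-i xᵀ Ω R) = exp(i ∑_j (p_j Q_j - q_j P_j))` on `L²(ℝ^N)`,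
where `Q_j` is multiplication by the `j`-th coordinate and `P_j = -i ∂_j`, that is,
`(W(q, p) ψ)(t) = exp(i (p·t - q·p/2)) ψ(t - q)`. -/
def weyl {N : ℕ} (x : PhaseSpace N) : ModeSpace N →L[ℂ] ModeSpace N :=
  LinearMap.mkContinuous
    { toFun := fun ψ => (memLp_weylFun x (Lp.memLp ψ)).toLp (weylFun x ψ)
      map_add' := fun ψ φ => by
        rw [← MemLp.toLp_add]
        refine MemLp.toLp_congr _ _ ((weylFun_congr_ae x (Lp.coeFn_add ψ φ)).trans ?_)
        exact Filter.Eventually.of_forall fun t => by simp [weylFun, mul_add]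
      map_smul' := fun c ψ => by
        rw [RingHom.id_apply, ← MemLp.toLp_const_smul]
        refine MemLp.toLp_congr _ _ ((weylFun_congr_ae x (Lp.coeFn_smul c ψ)).trans ?_)
        exact Filter.Eventually.of_forall fun t => by
          simp only [weylFun, Pi.smul_apply, smul_eq_mul]; ring }
    1
    (fun ψ => by
      rw [one_mul]
      apply le_of_eq
      change ‖(memLp_weylFun x (Lp.memLp ψ)).toLp (weylFun x ψ)‖ = ‖ψ‖
      rw [Lp.norm_toLp, Lp.norm_def, eLpNorm_weylFun x (Lp.aestronglyMeasurable ψ)])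

theorem coeFn_weyl {N : ℕ} (x : PhaseSpace N) (ψ : ModeSpace N) :
    weyl x ψ =ᵐ[volume] weylFun x ψ :=
  MemLp.coeFn_toLp (memLp_weylFun x (Lp.memLp ψ))

/-! ### Gaussian observables -/

/-- An observable on `ℝ^M` for `N` modes is Gaussian if its characteristic function is
`p ↦ exp(-pᵀBp/4 - i vᵀp) W(Ap)` for a real `2N × M` matrix `A`, a real `M × M` matrix `B` with
`B - i AᵀΩA ≥ 0`, and `v ∈ ℝ^M`. -/
def IsGaussian {N M : ℕ} (E : Observable (ModeSpace N) M) : Prop :=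
  ∃ (A : Matrix (Fin N × Fin 2) (Fin M) ℝ) (B : Matrix (Fin M) (Fin M) ℝ) (v : Fin M → ℝ),
    (B.map Complex.ofReal - Complex.I • (A.transpose * Omega N * A).map Complex.ofReal).PosSemidef ∧
    ∀ p : EuclideanSpace ℝ (Fin M),
      E.HasCharFunAt p
        (Complex.exp (-(1 / 4 : ℂ) * ((p.ofLp ⬝ᵥ B.mulVec p.ofLp : ℝ) : ℂ)
            - Complex.I * ((v ⬝ᵥ p.ofLp : ℝ) : ℂ)) • weyl (A.mulVec p.ofLp))

end GaussianObs

end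

/-! A Gaussian observable with matrix `A` reveals exactly the numbers `tr[ρ W(x)]` for `x` in the
range of `A`: the Gaussian prefactor never vanishes, and a finite measure is determined by its
characteristic function (`prob_eq_iff`, `IsGaussian.exists_submodule`). All the values `tr[ρ W(x)]`
together determine `ρ` (`IsState.ext_of_trace_weyl`), so an observable whose range is all of phase
space is informationally complete.

If none of finitely many observables is complete, their subspaces `K j` are all proper, and some
`x₀` lies outside their union. Choose `y j` symplectically orthogonal to `K j` with `ω(x₀, y j) =
π`. Displace one vector `g` by the sums `∑_{j ∈ S} y j` and mix uniformly, once over the even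
subsets `S` and once over the odd ones. By the Weyl relations, the characteristic functions of the
two states differ by a constant times `⟨g, W(x) g⟩ ∏_j (1 - exp(i ω(x, y j)))`. This vanishes on
every `K j` but not at `x₀`, so the family cannot separate the two states
(`exists_isState_ne_of_ne_top`). -/

namespace GaussianObs

/-! ### Trace-class decompositions of states -/

section Decomposition

universe u

variable {H : Type u} [NormedAddCommGroup H] [InnerProductSpace ℂ H]

/-- The vectors `u i` decompose the operator `ρ` as `∑ |u i⟩⟨u i|`, with `∑ ‖u i‖² < ∞`. -/
structure IsDecomposition {ι : Type*} (ρ : H →L[ℂ] H) (u : ι → H) : Prop where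
  summable : Summable fun i => ‖u i‖ ^ 2
  hasSum : ∀ φ ψ : H, HasSum (fun i => inner ℂ φ (u i) * inner ℂ (u i) ψ) (inner ℂ φ (ρ ψ))

theorem inner_self_eq_ofReal_norm_sq (x : H) : inner ℂ x x = ((‖x‖ ^ 2 : ℝ) : ℂ) := by
  rw [inner_self_eq_norm_sq_to_K]
  push_cast
  rfl

theorem inner_mul_inner_self_eq_ofReal (x y : H) :
    inner ℂ x y * inner ℂ y x = ((‖inner ℂ y x‖ ^ 2 : ℝ) : ℂ) := by
  rw [← inner_conj_symm x y, Complex.conj_mul']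
  push_cast
  rfl

theorem hasSum_norm_inner_sq {κ : Type*} (b : HilbertBasis κ ℂ H) (x : H) :
    HasSum (fun k => ‖inner ℂ (b k) x‖ ^ 2) (‖x‖ ^ 2) := by
  have h := b.hasSum_inner_mul_inner x x
  rw [inner_self_eq_ofReal_norm_sq] at h
  rw [← Complex.hasSum_ofReal]
  exact h.congr_fun fun k => (inner_mul_inner_self_eq_ofReal x (b k)).symm

namespace IsDecomposition

variable {ι : Type*} {ρ : H →L[ℂ] H} {u : ι → H}

theorem summable_inner (h : IsDecomposition ρ u) (T : H →L[ℂ] H) :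
    Summable fun i => inner ℂ (u i) (T (u i)) := by
  refine Summable.of_norm_bounded (h.summable.mul_left ‖T‖) fun i => ?_
  calc ‖inner ℂ (u i) (T (u i))‖ ≤ ‖u i‖ * ‖T (u i)‖ := norm_inner_le_norm _ _
    _ ≤ ‖u i‖ * (‖T‖ * ‖u i‖) := by gcongr; exact T.le_opNorm _
    _ = ‖T‖ * ‖u i‖ ^ 2 := by ring

theorem isPositive (h : IsDecomposition ρ u) : ρ.IsPositive := by
  rw [ContinuousLinearMap.isPositive_iff_complex]
  intro x
  have hx : HasSum (fun i => ((‖inner ℂ (u i) x‖ ^ 2 : ℝ) : ℂ)) (inner ℂ x (ρ x)) :=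
    (h.hasSum x x).congr_fun fun i => (inner_mul_inner_self_eq_ofReal x (u i)).symm
  have h0 : 0 ≤ inner ℂ x (ρ x) := hx.nonneg fun i => by
    rw [Complex.zero_le_real]
    positivity
  have h1 : 0 ≤ inner ℂ (ρ x) x := by
    rw [← inner_conj_symm, ← Complex.star_def]
    exact star_nonneg_iff.2 h0
  exact ⟨Complex.ext rfl (by simpa using (Complex.nonneg_iff.1 h1).2), (Complex.nonneg_iff.1 h1).1⟩

end IsDecomposition

/-- A finite sum of rank one operators `|u i⟩⟨u i|`. -/
theorem isDecomposition_sum_rankOne {ι : Type*} [Fintype ι] (u : ι → H) :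
    IsDecomposition (∑ i, InnerProductSpace.rankOne ℂ (u i) (u i)) u := by
  refine ⟨(hasSum_fintype _).summable, fun φ ψ => ?_⟩
  have : inner ℂ φ ((∑ i, InnerProductSpace.rankOne ℂ (u i) (u i)) ψ) =
      ∑ i, inner ℂ φ (u i) * inner ℂ (u i) ψ := by
    simp [mul_comm]
  rw [this]
  exact hasSum_fintype _

variable [CompleteSpace H]

theorem HasTrace.unique {T : H →L[ℂ] H} {s t : ℂ} (hs : HasTrace T s) (ht : HasTrace T t) :
    s = t := by
  obtain ⟨w, b, -⟩ := exists_hilbertBasis ℂ H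
  exact (hs w b).unique (ht w b)

theorem HasTrace.trace_eq {T : H →L[ℂ] H} {t : ℂ} (ht : HasTrace T t) : trace T = t := by
  have h : ∃ t, HasTrace T t := ⟨t, ht⟩
  rw [trace, dif_pos h]
  exact h.choose_spec.unique ht

namespace IsDecomposition

variable {ι : Type*} {ρ : H →L[ℂ] H} {u : ι → H}

/-- If `ρ = ∑ |u i⟩⟨u i|` then `tr[ρ T] = ∑ ⟨u i, T u i⟩`. -/
theorem hasTrace_comp (h : IsDecomposition ρ u) (T : H →L[ℂ] H) :
    HasTrace (ρ ∘L T) (∑' i, inner ℂ (u i) (T (u i))) := by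
  intro κ b
  set S := ContinuousLinearMap.adjoint T
  let f : ι × κ → ℂ := fun x => inner ℂ (S (u x.1)) (b x.2) * inner ℂ (b x.2) (u x.1)
  -- Absolute summability from `|ab| ≤ a² + b²` and Parseval in the basis `b`.
  have hf : Summable f := by
    have hg : Summable fun x : ι × κ =>
        ‖inner ℂ (b x.2) (S (u x.1))‖ ^ 2 + ‖inner ℂ (b x.2) (u x.1)‖ ^ 2 := by
      have h1 := fun i => (hasSum_norm_inner_sq b (S (u i))).add (hasSum_norm_inner_sq b (u i))
      rw [summable_prod_of_nonneg fun _ => by positivity]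
      refine ⟨fun i => (h1 i).summable, ?_⟩
      simp_rw [(h1 _).tsum_eq]
      refine Summable.of_nonneg_of_le (fun _ => by positivity) (fun i => ?_)
        ((h.summable.mul_left (‖S‖ ^ 2)).add h.summable)
      gcongr
      rw [← mul_pow]
      gcongr
      exact S.le_opNorm _
    refine Summable.of_norm_bounded hg fun x => ?_
    rw [norm_mul, norm_inner_symm (S _)]
    nlinarith [sq_nonneg (‖inner ℂ (b x.2) (S (u x.1))‖ - ‖inner ℂ (b x.2) (u x.1)‖),
      sq_nonneg (‖inner ℂ (b x.2) (S (u x.1))‖), sq_nonneg ‖inner ℂ (b x.2) (u x.1)‖]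
  -- The double series is summed in both orders: over the basis first it gives `∑ ⟨u i, T (u i)⟩`,
  -- over `i` first it gives the diagonal of `ρ T`.
  have hrow := hf.hasSum.prod_fiberwise fun i => b.hasSum_inner_mul_inner (S (u i)) (u i)
  have hcol := ((Equiv.prodComm κ ι).hasSum_iff.mpr hf.hasSum).prod_fiberwise
    (g := fun k => inner ℂ (b k) ((ρ ∘L T) (b k))) fun k => by
      refine (h.hasSum (b k) (T (b k))).congr_fun fun i => ?_
      simp only [f, S, Function.comp_apply, Equiv.prodComm_apply, Prod.swap_prod_mk,
        ContinuousLinearMap.adjoint_inner_left]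
      ring
  simp only [S, ContinuousLinearMap.adjoint_inner_left] at hrow
  rwa [← hrow.tsum_eq] at hcol

theorem trace_comp (h : IsDecomposition ρ u) (T : H →L[ℂ] H) :
    trace (ρ ∘L T) = ∑' i, inner ℂ (u i) (T (u i)) :=
  (h.hasTrace_comp T).trace_eq

theorem isState (h : IsDecomposition ρ u) (h1 : ∑' i, ‖u i‖ ^ 2 = 1) : IsState ρ := by
  refine ⟨h.isPositive, ?_⟩
  have := h.hasTrace_comp (ContinuousLinearMap.id ℂ H)
  simp only [ContinuousLinearMap.comp_id, ContinuousLinearMap.id_apply,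
    inner_self_eq_ofReal_norm_sq, ← Complex.ofReal_tsum, h1, Complex.ofReal_one] at this
  exact this

end IsDecomposition

/-- The vectors are `√ρ (b i)` for a Hilbert basis `b`; their squared norms sum to the trace.
Countability is needed later to exchange sums with integrals. -/
theorem IsState.exists_isDecomposition {ρ : H →L[ℂ] H} (hρ : IsState ρ) :
    ∃ (ι : Type u) (_ : Countable ι) (u : ι → H), IsDecomposition ρ u := by
  obtain ⟨w, b, -⟩ := exists_hilbertBasis ℂ H
  have hpos : 0 ≤ ρ := (ContinuousLinearMap.nonneg_iff_isPositive ρ).2 hρ.1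
  set S := CFC.sqrt ρ
  have hS : S * S = ρ := CFC.sqrt_mul_sqrt_self ρ
  have hS' : ContinuousLinearMap.adjoint S = S :=
    (IsSelfAdjoint.of_nonneg (CFC.sqrt_nonneg ρ)).adjoint_eq
  have hinner : ∀ φ ψ, inner ℂ φ (ρ ψ) = inner ℂ (S φ) (S ψ) := fun φ ψ => by
    rw [← hS, mul_apply_eq_comp, ← ContinuousLinearMap.adjoint_inner_left, hS']
  have hmove : ∀ φ ψ, inner ℂ (S φ) ψ = inner ℂ φ (S ψ) := fun φ ψ => by
    rw [← ContinuousLinearMap.adjoint_inner_left, hS']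
  have hsum : Summable fun i => ‖S (b i)‖ ^ 2 := by
    have h := (hρ.2 w b).summable
    simp only [hinner, inner_self_eq_ofReal_norm_sq] at h
    exact Complex.summable_ofReal.1 h
  have hdec : IsDecomposition ρ fun i => S (b i) := ⟨hsum, fun φ ψ => by
    simpa only [hinner, hmove] using b.hasSum_inner_mul_inner (S φ) (S ψ)⟩
  -- A summable family has countable support, and dropping the zero vectors changes no sum.
  refine ⟨Function.support fun i => ‖S (b i)‖ ^ 2, hsum.countable_support.to_subtype,
    fun i => S (b i), hsum.subtype _, fun φ ψ => ?_⟩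
  refine (hasSum_subtype_iff_of_support_subset
    (f := fun i => inner ℂ φ (S (b i)) * inner ℂ (S (b i)) ψ) fun i hi => ?_).2 (hdec.hasSum φ ψ)
  contrapose! hi
  have : S (b i) = 0 := by simpa using hi
  simp [this]

end Decomposition

/-! ### Outcome distributions and their characteristic functions -/

section Outcome

universe u

variable {H : Type u} [NormedAddCommGroup H] [InnerProductSpace ℂ H] {M : ℕ}

namespace Observable

/-- The outcome distribution of `E` in the operator `∑ |u i⟩⟨u i|`. -/
noncomputable def outcomeMeasure {ι : Type*} (E : Observable H M) (u : ι → H) :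
    Measure (EuclideanSpace ℝ (Fin M)) :=
  Measure.sum fun i => E.vectorMeasure (u i)

theorem ofReal_re_inner (E : Observable H M) {X : Set (EuclideanSpace ℝ (Fin M))}
    (hX : MeasurableSet X) (ψ : H) :
    (((inner ℂ ψ (E.toFun X ψ)).re : ℝ) : ℂ) = inner ℂ ψ (E.toFun X ψ) := by
  have := (E.positive X hX).inner_nonneg_right ψ
  exact Complex.ext rfl (by simp [← (Complex.nonneg_iff.1 this).2])

variable {ι : Type*} {ρ : H →L[ℂ] H} {u : ι → H}

theorem outcomeMeasure_apply (E : Observable H M) (h : IsDecomposition ρ u)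
    {X : Set (EuclideanSpace ℝ (Fin M))} (hX : MeasurableSet X) :
    E.outcomeMeasure u X = ENNReal.ofReal (∑' i, (inner ℂ (u i) (E.toFun X (u i))).re) := by
  have h0 : ∀ i, 0 ≤ (inner ℂ (u i) (E.toFun X (u i))).re := fun i =>
    (E.positive X hX).re_inner_nonneg_right (u i)
  rw [outcomeMeasure, Measure.sum_apply _ hX, ENNReal.ofReal_tsum_of_nonneg h0
    (Complex.hasSum_re (h.summable_inner _).hasSum).summable]
  simp only [E.vectorMeasure_apply _ hX]

theorem isFiniteMeasure_outcomeMeasure (E : Observable H M) (h : IsDecomposition ρ u) :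
    IsFiniteMeasure (E.outcomeMeasure u) :=
  ⟨by rw [E.outcomeMeasure_apply h MeasurableSet.univ]; exact ENNReal.ofReal_lt_top⟩

variable [CompleteSpace H]

theorem prob_eq (E : Observable H M) (h : IsDecomposition ρ u)
    {X : Set (EuclideanSpace ℝ (Fin M))} (hX : MeasurableSet X) :
    E.prob ρ X = ((E.outcomeMeasure u X).toReal : ℂ) := by
  have h0 : ∀ i, 0 ≤ (inner ℂ (u i) (E.toFun X (u i))).re := fun i =>
    (E.positive X hX).re_inner_nonneg_right (u i)
  rw [prob, h.trace_comp, E.outcomeMeasure_apply h hX, ENNReal.toReal_ofReal (tsum_nonneg h0),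
    Complex.ofReal_tsum]
  simp only [E.ofReal_re_inner hX]

theorem charFun_outcomeMeasure (E : Observable H M) (h : IsDecomposition ρ u)
    {p : EuclideanSpace ℝ (Fin M)} {c : ℂ} {T : H →L[ℂ] H} (hE : E.HasCharFunAt p (c • T)) :
    charFun (E.outcomeMeasure u) p = c * trace (ρ ∘L T) := by
  have := E.isFiniteMeasure_outcomeMeasure h
  have hint : Integrable (fun x : EuclideanSpace ℝ (Fin M) =>
      Complex.exp (inner ℝ x p * Complex.I)) (E.outcomeMeasure u) := by
    refine Integrable.of_bound (Continuous.aestronglyMeasurable (by fun_prop)) 1 ?_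
    exact Filter.Eventually.of_forall fun x => by rw [Complex.norm_exp_ofReal_mul_I]
  rw [charFun_apply, outcomeMeasure, ← (hasSum_integral_measure hint).tsum_eq, h.trace_comp, ← tsum_mul_left]
  refine tsum_congr fun i => ?_
  rw [← charFun_apply, hE (u i)]
  simp

/-- Two states have the same outcome distribution exactly if they agree on the operators which
are, up to nonzero factors, the values of the characteristic function. -/
theorem prob_eq_iff (E : Observable H M) {ρ σ : H →L[ℂ] H} (hρ : IsState ρ) (hσ : IsState σ)
    {c : EuclideanSpace ℝ (Fin M) → ℂ} (hc : ∀ p, c p ≠ 0)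
    {T : EuclideanSpace ℝ (Fin M) → H →L[ℂ] H} (hE : ∀ p, E.HasCharFunAt p (c p • T p)) :
    (∀ X, MeasurableSet X → E.prob ρ X = E.prob σ X) ↔
      ∀ p, trace (ρ ∘L T p) = trace (σ ∘L T p) := by
  obtain ⟨ι, -, u, hu⟩ := hρ.exists_isDecomposition
  obtain ⟨κ, -, w, hw⟩ := hσ.exists_isDecomposition
  have := E.isFiniteMeasure_outcomeMeasure hu
  have := E.isFiniteMeasure_outcomeMeasure hw
  constructor
  · intro h p
    have hμ : E.outcomeMeasure u = E.outcomeMeasure w := by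
      ext X hX
      have := h X hX
      rw [E.prob_eq hu hX, E.prob_eq hw hX, Complex.ofReal_inj] at this
      exact (ENNReal.toReal_eq_toReal_iff' (measure_ne_top _ _) (measure_ne_top _ _)).1 this
    have h1 := E.charFun_outcomeMeasure hu (hE p)
    rw [hμ, E.charFun_outcomeMeasure hw (hE p)] at h1
    exact (mul_left_cancel₀ (hc p) h1).symm
  · intro h X hX
    have hμ : E.outcomeMeasure u = E.outcomeMeasure w := by
      refine Measure.ext_of_charFun (funext fun p => ?_)
      rw [E.charFun_outcomeMeasure hu (hE p), E.charFun_outcomeMeasure hw (hE p), h p]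
    rw [E.prob_eq hu hX, E.prob_eq hw hX, hμ]

end Observable

end Outcome

end GaussianObs

namespace GaussianObs

/-! ### Injectivity of the Fourier transform on integrable functions -/

section Fourier

theorem integrable_tsum_of_summable_integral_norm {α ι E : Type*} [MeasurableSpace α]
    {μ : Measure α} [NormedAddCommGroup E] [CompleteSpace E] [Countable ι] {F : ι → α → E}
    (hF : ∀ i, Integrable (F i) μ) (hsum : Summable fun i => ∫ a, ‖F i a‖ ∂μ) :
    Integrable (fun a => ∑' i, F i a) μ := by
  have hfin : ∫⁻ a, ∑' i, ‖F i a‖ₑ ∂μ < ∞ := by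
    rw [lintegral_tsum fun i => (hF i).1.enorm]
    have h : ∀ i, ∫⁻ a, ‖F i a‖ₑ ∂μ = ENNReal.ofReal (∫ a, ‖F i a‖ ∂μ) := fun i =>
      (ofReal_integral_norm_eq_lintegral_enorm (hF i)).symm
    simp_rw [h]
    rw [← ENNReal.ofReal_tsum_of_nonneg (fun i => integral_nonneg fun a => norm_nonneg _) hsum]
    exact ENNReal.ofReal_lt_top
  have hae : ∀ᵐ a ∂μ, Summable fun i => F i a := by
    filter_upwards [ae_lt_top' (AEMeasurable.tsum fun i => (hF i).1.enorm) hfin.ne]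
      with a ha
    refine Summable.of_nnnorm ?_
    rw [← ENNReal.tsum_coe_ne_top_iff_summable]
    exact ha.ne
  refine ⟨aestronglyMeasurable_of_tendsto_ae Filter.atTop
    (fun s : Finset ι => Finset.aestronglyMeasurable_fun_sum s fun i _ => (hF i).1)
    (hae.mono fun a ha => ha.hasSum), ?_⟩
  refine lt_of_le_of_lt (lintegral_mono fun a => ?_) hfin
  exact enorm_tsum_le_tsum_enorm

variable {V : Type*} [NormedAddCommGroup V] [InnerProductSpace ℝ V] [MeasurableSpace V]
  [BorelSpace V] {μ : Measure V}

theorem integrable_exp_inner_mul {f : V → ℂ} (hf : Integrable f μ) (p : V) :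
    Integrable (fun x => Complex.exp (inner ℝ x p * Complex.I) * f x) μ := by
  refine hf.bdd_mul (c := 1) (Continuous.aestronglyMeasurable (by fun_prop)) ?_
  exact Filter.Eventually.of_forall fun x => by rw [Complex.norm_exp_ofReal_mul_I]

variable [SecondCountableTopology V] [CompleteSpace V] [SigmaFinite μ]

/-- The positive and negative parts of `f` are densities of two finite measures with the same
characteristic function, hence of the same measure. -/
theorem ae_eq_zero_of_fourier_eq_zero_of_real {f : V → ℝ} (hf : Integrable f μ)
    (h : ∀ p : V, ∫ x, Complex.exp (inner ℝ x p * Complex.I) * (f x : ℂ) ∂μ = 0) :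
    f =ᵐ[μ] 0 := by
  have hpos : AEMeasurable (fun x => ENNReal.ofReal (f x)) μ := hf.1.aemeasurable.ennreal_ofReal
  have hneg : AEMeasurable (fun x => ENNReal.ofReal (-f x)) μ :=
    hf.1.aemeasurable.neg.ennreal_ofReal
  have := isFiniteMeasure_withDensity_ofReal hf.2
  have := isFiniteMeasure_withDensity_ofReal hf.neg.2
  have hμ : μ.withDensity (fun x => ENNReal.ofReal (f x)) =
      μ.withDensity (fun x => ENNReal.ofReal (-f x)) := by
    refine Measure.ext_of_charFun (funext fun p => ?_)
    rw [charFun_apply, charFun_apply,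
      integral_withDensity_eq_integral_toReal_smul₀ hpos (by simp),
      integral_withDensity_eq_integral_toReal_smul₀ hneg (by simp), ← sub_eq_zero,
      ← integral_sub, ← h p]
    · refine integral_congr_ae (Filter.Eventually.of_forall fun x => ?_)
      simp only [ENNReal.toReal_ofReal', Complex.real_smul]
      rw [← sub_mul, ← Complex.ofReal_sub, mul_comm, max_zero_sub_max_neg_zero_eq_self]
    · convert integrable_exp_inner_mul hf.pos_part.ofReal p using 2 with x
      simp [ENNReal.toReal_ofReal', mul_comm]
    · convert integrable_exp_inner_mul hf.neg_part.ofReal p using 2 with x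
      simp [ENNReal.toReal_ofReal', mul_comm]
  filter_upwards [(withDensity_eq_iff_of_sigmaFinite hpos hneg).1 hμ] with x hx
  rcases le_total 0 (f x) with h0 | h0
  · rw [ENNReal.ofReal_of_nonpos (neg_nonpos.2 h0), ENNReal.ofReal_eq_zero] at hx
    exact le_antisymm hx h0
  · rw [ENNReal.ofReal_of_nonpos h0, eq_comm, ENNReal.ofReal_eq_zero] at hx
    exact le_antisymm h0 (by simpa using hx)

/-- An integrable function whose Fourier transform vanishes is zero almost everywhere. -/
theorem ae_eq_zero_of_fourier_eq_zero {f : V → ℂ} (hf : Integrable f μ)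
    (h : ∀ p : V, ∫ x, Complex.exp (inner ℝ x p * Complex.I) * f x ∂μ = 0) :
    f =ᵐ[μ] 0 := by
  have hconj : Integrable (fun x => (starRingEnd ℂ) (f x)) μ := by
    simpa using (LinearIsometryEquiv.integrable_comp_iff Complex.conjLIE).2 hf
  -- The transform of the conjugate at `p` is the conjugate of the transform at `-p`; real and
  -- imaginary parts can then be treated separately.
  have h' : ∀ p : V, ∫ x, Complex.exp (inner ℝ x p * Complex.I) * (starRingEnd ℂ) (f x) ∂μ = 0 := by
    intro p
    have := congrArg (starRingEnd ℂ) (h (-p))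
    rw [← integral_conj, map_zero] at this
    rw [← this]
    refine integral_congr_ae (Filter.Eventually.of_forall fun x => ?_)
    simp [← Complex.exp_conj]
  have hre := ae_eq_zero_of_fourier_eq_zero_of_real hf.re fun p => by
    have : ∀ x, Complex.exp (inner ℝ x p * Complex.I) * ((RCLike.re (f x) : ℝ) : ℂ) =
        (Complex.exp (inner ℝ x p * Complex.I) * f x +
          Complex.exp (inner ℝ x p * Complex.I) * (starRingEnd ℂ) (f x)) * (1 / 2) := fun x => by
      rw [← mul_add, Complex.add_conj]
      simp only [RCLike.re_to_complex]
      push_cast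
      ring
    simp_rw [this]
    rw [integral_mul_const, integral_add (integrable_exp_inner_mul hf p)
      (integrable_exp_inner_mul hconj p), h, h', add_zero, zero_mul]
  have him := ae_eq_zero_of_fourier_eq_zero_of_real hf.im fun p => by
    have : ∀ x, Complex.exp (inner ℝ x p * Complex.I) * ((RCLike.im (f x) : ℝ) : ℂ) =
        (Complex.exp (inner ℝ x p * Complex.I) * f x -
          Complex.exp (inner ℝ x p * Complex.I) * (starRingEnd ℂ) (f x)) *
            (1 / (2 * Complex.I)) := fun x => by
      rw [← mul_sub, Complex.sub_conj]
      simp only [RCLike.im_to_complex]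
      push_cast
      field_simp
    simp_rw [this]
    rw [integral_mul_const, integral_sub (integrable_exp_inner_mul hf p)
      (integrable_exp_inner_mul hconj p), h, h', sub_zero, zero_mul]
  filter_upwards [hre, him] with x h1 h2
  exact Complex.ext h1 h2

end Fourier

/-! ### Cauchy–Schwarz for square-integrable functions -/

section CauchySchwarz

variable {α : Type*} [MeasurableSpace α] {μ : Measure α}

theorem integrable_conj_mul {f g : α → ℂ} (hf : MemLp f 2 μ) (hg : MemLp g 2 μ) :
    Integrable (fun a => (starRingEnd ℂ) (f a) * g a) μ := by
  have hf' : MemLp (fun a => (starRingEnd ℂ) (f a)) 2 μ := hf.star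
  exact hf'.integrable_mul hg

theorem integral_norm_conj_mul_le {f g : α → ℂ} (hf : MemLp f 2 μ) (hg : MemLp g 2 μ) :
    ∫ a, ‖(starRingEnd ℂ) (f a) * g a‖ ∂μ ≤ (eLpNorm f 2 μ).toReal * (eLpNorm g 2 μ).toReal := by
  have h := real_inner_le_norm (hf.norm.toLp _) (hg.norm.toLp _)
  rw [Lp.norm_toLp, Lp.norm_toLp, eLpNorm_norm, eLpNorm_norm, L2.inner_def] at h
  refine le_trans (le_of_eq ?_) h
  refine integral_congr_ae ?_
  filter_upwards [hf.norm.coeFn_toLp, hg.norm.coeFn_toLp] with a h1 h2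
  rw [h1, h2]
  simp [mul_comm]

end CauchySchwarz

/-! ### States are determined by their Weyl expectations -/

section WeylInjective

variable {N : ℕ}

/-- The phase space point with position `q` and momentum `p`. -/
def PhaseSpace.mk (q p : EuclideanSpace ℝ (Fin N)) : PhaseSpace N := fun jk => ![q jk.1, p jk.1] jk.2

@[simp] theorem PhaseSpace.pos_mk (q p : EuclideanSpace ℝ (Fin N)) :
    (PhaseSpace.mk q p).pos = q := by
  ext j; simp [PhaseSpace.pos, PhaseSpace.mk]

@[simp] theorem PhaseSpace.mom_mk (q p : EuclideanSpace ℝ (Fin N)) :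
    (PhaseSpace.mk q p).mom = p := by
  ext j; simp [PhaseSpace.mom, PhaseSpace.mk]

theorem inner_modeSpace (φ ψ : ModeSpace N) :
    inner ℂ φ ψ = ∫ t, (starRingEnd ℂ) (φ t) * ψ t := by
  rw [L2.inner_def]
  simp [RCLike.inner_apply, mul_comm]

/-- For fixed `q`, the matrix element is, up to a phase, a Fourier transform in `p`; this lets
Fourier inversion be applied one displacement at a time. -/
theorem inner_weyl_mk (q p : EuclideanSpace ℝ (Fin N)) (φ ψ : ModeSpace N) :
    Complex.exp (Complex.I * ((inner ℝ q p / 2 : ℝ) : ℂ)) * inner ℂ φ (weyl (.mk q p) ψ) =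
      ∫ t, Complex.exp (inner ℝ t p * Complex.I) * ((starRingEnd ℂ) (φ t) * ψ (t - q)) := by
  rw [inner_modeSpace, ← integral_const_mul]
  refine integral_congr_ae ?_
  filter_upwards [coeFn_weyl (.mk q p) ψ] with t ht
  have : Complex.exp (inner ℝ t p * Complex.I) =
      Complex.exp (Complex.I * ((inner ℝ q p / 2 : ℝ) : ℂ)) *
        Complex.exp (Complex.I * ((inner ℝ p t - inner ℝ q p / 2 : ℝ) : ℂ)) := by
    rw [← Complex.exp_add, real_inner_comm]
    congr 1
    push_cast
    ring
  simp only [ht, weylFun, PhaseSpace.pos_mk, PhaseSpace.mom_mk, this]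
  ring

theorem memLp_shift (ψ : ModeSpace N) (q : EuclideanSpace ℝ (Fin N)) :
    MemLp (fun t => ψ (t - q)) 2 volume :=
  (Lp.memLp ψ).comp_measurePreserving (measurePreserving_sub_right volume q)

theorem eLpNorm_shift (ψ : ModeSpace N) (q : EuclideanSpace ℝ (Fin N)) :
    (eLpNorm (fun t => ψ (t - q)) 2 volume).toReal = ‖ψ‖ := by
  rw [Lp.norm_def, ← eLpNorm_comp_measurePreserving (Lp.aestronglyMeasurable ψ)
    (measurePreserving_sub_right volume q)]
  rfl

variable {ι : Type*} {ρ σ : ModeSpace N →L[ℂ] ModeSpace N} {u : ι → ModeSpace N}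

/-- The value `∑ conj (u i t) * u i (t - q)` at `(t - q, t)` of the integral kernel of
`∑ |u i⟩⟨u i|`. -/
noncomputable def kernelAt (u : ι → ModeSpace N) (q t : EuclideanSpace ℝ (Fin N)) : ℂ :=
  ∑' i, (starRingEnd ℂ) (u i t) * u i (t - q)

theorem IsDecomposition.summable_integral_norm (h : IsDecomposition ρ u)
    (q : EuclideanSpace ℝ (Fin N)) :
    Summable fun i => ∫ t, ‖(starRingEnd ℂ) (u i t) * u i (t - q)‖ := by
  refine Summable.of_nonneg_of_le (fun i => integral_nonneg fun t => norm_nonneg _)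
    (fun i => ?_) h.summable
  refine (integral_norm_conj_mul_le (Lp.memLp (u i)) (memLp_shift (u i) q)).trans (le_of_eq ?_)
  rw [eLpNorm_shift, ← Lp.norm_def, sq]

variable [Countable ι]

theorem IsDecomposition.integrable_kernelAt (h : IsDecomposition ρ u)
    (q : EuclideanSpace ℝ (Fin N)) : Integrable (kernelAt u q) :=
  integrable_tsum_of_summable_integral_norm
    (fun i => integrable_conj_mul (Lp.memLp (u i)) (memLp_shift (u i) q))
    (h.summable_integral_norm q)

theorem IsDecomposition.fourier_kernelAt (h : IsDecomposition ρ u)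
    (q p : EuclideanSpace ℝ (Fin N)) :
    ∫ t, Complex.exp (inner ℝ t p * Complex.I) * kernelAt u q t =
      Complex.exp (Complex.I * ((inner ℝ q p / 2 : ℝ) : ℂ)) * trace (ρ ∘L weyl (.mk q p)) := by
  rw [h.trace_comp, ← tsum_mul_left]
  simp_rw [inner_weyl_mk, kernelAt, ← tsum_mul_left]
  refine (integral_tsum_of_summable_integral_norm (fun i => integrable_exp_inner_mul
    (integrable_conj_mul (Lp.memLp (u i)) (memLp_shift (u i) q)) p) ?_).symm
  refine (h.summable_integral_norm q).congr fun i => ?_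
  simp_rw [norm_mul (Complex.exp _), Complex.norm_exp_ofReal_mul_I, one_mul]

/-- The shear `(x, t) ↦ (x + t, t)` preserves volume and turns the double integral of the kernel of
`ρ` into integrals along its diagonals, where `kernelAt` lives. -/
theorem IsDecomposition.inner_eq_integral_kernelAt (h : IsDecomposition ρ u) (φ ψ : ModeSpace N) :
    inner ℂ φ (ρ ψ) = ∫ x, ∫ t, (starRingEnd ℂ) (φ (x + t)) * ψ t * kernelAt u (-x) t := by
  let g : ι → EuclideanSpace ℝ (Fin N) × EuclideanSpace ℝ (Fin N) → ℂ := fun i z =>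
    ((starRingEnd ℂ) (φ z.1) * u i z.1) * ((starRingEnd ℂ) (u i z.2) * ψ z.2)
  have hmp := measurePreserving_add_prod (volume : Measure (EuclideanSpace ℝ (Fin N)))
    (volume : Measure (EuclideanSpace ℝ (Fin N)))
  set sh : EuclideanSpace ℝ (Fin N) × EuclideanSpace ℝ (Fin N) →
    EuclideanSpace ℝ (Fin N) × EuclideanSpace ℝ (Fin N) := fun z => (z.1 + z.2, z.2)
  have hg : ∀ i, Integrable (g i) (volume.prod volume) := fun i =>
    (integrable_conj_mul (Lp.memLp φ) (Lp.memLp (u i))).mul_prod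
      (integrable_conj_mul (Lp.memLp (u i)) (Lp.memLp ψ))
  have hgs : ∀ i, Integrable (fun z => g i (sh z)) (volume.prod volume) := fun i =>
    hmp.integrable_comp_of_integrable (hg i)
  have hsum : Summable fun i => ∫ z, ‖g i (sh z)‖ ∂volume.prod volume := by
    refine Summable.of_nonneg_of_le (fun i => integral_nonneg fun t => norm_nonneg _)
      (fun i => ?_) (h.summable.mul_left (‖φ‖ * ‖ψ‖))
    have h1 : ∫ z, ‖g i (sh z)‖ ∂volume.prod volume = ∫ z, ‖g i z‖ ∂volume.prod volume := by
      conv_rhs => rw [← hmp.map_eq]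
      rw [integral_map hmp.measurable.aemeasurable]
      rw [hmp.map_eq]
      exact (hg i).1.norm
    have h2 : ∫ z, ‖g i z‖ ∂volume.prod volume =
        (∫ s, ‖(starRingEnd ℂ) (φ s) * u i s‖) * ∫ t, ‖(starRingEnd ℂ) (u i t) * ψ t‖ := by
      rw [← integral_prod_mul]
      simp only [g, norm_mul]
    rw [h1, h2]
    calc _ ≤ (‖φ‖ * ‖u i‖) * (‖u i‖ * ‖ψ‖) := by
          refine mul_le_mul ?_ ?_ (integral_nonneg fun t => norm_nonneg _) (by positivity)
          · exact integral_norm_conj_mul_le (Lp.memLp φ) (Lp.memLp (u i))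
          · exact integral_norm_conj_mul_le (Lp.memLp (u i)) (Lp.memLp ψ)
      _ = _ := by ring
  have hval : ∀ i, ∫ z, g i (sh z) ∂volume.prod volume =
      inner ℂ φ (u i) * inner ℂ (u i) ψ := fun i => by
    rw [inner_modeSpace, inner_modeSpace, ← integral_prod_mul]
    conv_rhs => rw [← hmp.map_eq]
    rw [integral_map hmp.measurable.aemeasurable]
    rw [hmp.map_eq]
    exact (hg i).1
  have key := hasSum_integral_of_summable_integral_norm hgs hsum
  simp_rw [hval] at key
  rw [(h.hasSum φ ψ).unique key, integral_prod _
    (integrable_tsum_of_summable_integral_norm hgs hsum)]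
  simp_rw [kernelAt, ← tsum_mul_left, g, sh]
  refine integral_congr_ae (Filter.Eventually.of_forall fun x => ?_)
  refine integral_congr_ae (Filter.Eventually.of_forall fun t => ?_)
  refine tsum_congr fun i => ?_
  simp only [sub_neg_eq_add, add_comm t x]
  ring

/-- A state is determined by the function `x ↦ tr[ρ W(x)]`. -/
theorem IsState.ext_of_trace_weyl (hρ : IsState ρ) (hσ : IsState σ)
    (h : ∀ x, trace (ρ ∘L weyl x) = trace (σ ∘L weyl x)) : ρ = σ := by
  obtain ⟨ι, _, u, hu⟩ := hρ.exists_isDecomposition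
  obtain ⟨κ, _, w, hw⟩ := hσ.exists_isDecomposition
  -- The null set may depend on `q`; this suffices, since the kernel is integrated over `t` first.
  have hker : ∀ q, kernelAt u q =ᵐ[volume] kernelAt w q := fun q => by
    have : (fun t => kernelAt u q t - kernelAt w q t) =ᵐ[volume] 0 := by
      refine ae_eq_zero_of_fourier_eq_zero
        ((hu.integrable_kernelAt q).sub (hw.integrable_kernelAt q)) fun p => ?_
      simp_rw [mul_sub]
      rw [integral_sub (integrable_exp_inner_mul (hu.integrable_kernelAt q) p)
        (integrable_exp_inner_mul (hw.integrable_kernelAt q) p), hu.fourier_kernelAt,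
        hw.fourier_kernelAt, h, sub_self]
    exact this.mono fun t ht => sub_eq_zero.1 ht
  refine ContinuousLinearMap.ext fun ψ => ext_inner_left ℂ fun φ => ?_
  rw [hu.inner_eq_integral_kernelAt, hw.inner_eq_integral_kernelAt]
  refine integral_congr_ae (Filter.Eventually.of_forall fun x => ?_)
  refine integral_congr_ae ?_
  filter_upwards [hker (-x)] with t ht
  rw [ht]

end WeylInjective

end GaussianObs

namespace GaussianObs

/-! ### Weyl covariance and the symplectic form -/

section WeylRelations

variable {N : ℕ}

theorem norm_weyl_apply (x : PhaseSpace N) (ψ : ModeSpace N) : ‖weyl x ψ‖ = ‖ψ‖ := by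
  change ‖(memLp_weylFun x (Lp.memLp ψ)).toLp (weylFun x ψ)‖ = ‖ψ‖
  rw [Lp.norm_toLp, Lp.norm_def, eLpNorm_weylFun x (Lp.aestronglyMeasurable ψ)]

/-- The symplectic form on phase space. -/
noncomputable def sympl (x y : PhaseSpace N) : ℝ :=
  ∑ j, (x (j, 1) * y (j, 0) - x (j, 0) * y (j, 1))

theorem sympl_eq_inner (x y : PhaseSpace N) :
    sympl x y = inner ℝ x.mom y.pos - inner ℝ y.mom x.pos := by
  simp [sympl, PhaseSpace.mom, PhaseSpace.pos, PiLp.inner_apply, Finset.sum_sub_distrib, mul_comm]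

theorem sympl_sum {J : Type*} (x : PhaseSpace N) (s : Finset J) (y : J → PhaseSpace N) :
    sympl x (∑ j ∈ s, y j) = ∑ j ∈ s, sympl x (y j) := by
  simp only [sympl, Finset.sum_apply, Finset.mul_sum, ← Finset.sum_sub_distrib]
  exact Finset.sum_comm

/-- Every linear functional on phase space is given by the symplectic form. -/
theorem exists_sympl_eq (f : PhaseSpace N →ₗ[ℝ] ℝ) : ∃ y, ∀ x, sympl x y = f x := by
  refine ⟨fun jk => ![f (Pi.single (jk.1, 1) 1), -f (Pi.single (jk.1, 0) 1)] jk.2, fun x => ?_⟩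
  rw [f.pi_apply_eq_sum_univ x, Fintype.sum_prod_type]
  refine Finset.sum_congr rfl fun j _ => ?_
  have h : ∀ k : Fin N × Fin 2, (fun l => if k = l then (1 : ℝ) else 0) = Pi.single k 1 :=
    fun k => by ext l; simp [Pi.single_apply, eq_comm]
  simp [h, Fin.sum_univ_two]
  ring

/-- The covariance relation `W(y)* W(x) W(y) = exp(i ω(x, y)) W(x)`, in expectation values. -/
theorem inner_weyl_conj (x y : PhaseSpace N) (g : ModeSpace N) :
    inner ℂ (weyl y g) (weyl x (weyl y g)) =
      Complex.exp (Complex.I * (sympl x y : ℂ)) * inner ℂ g (weyl x g) := by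
  -- Translating the right-hand integral by the position of `y` makes the integrands agree up to a
  -- comparison of phases.
  rw [inner_modeSpace, inner_modeSpace, ← integral_const_mul,
    ← integral_sub_right_eq_self (fun t => Complex.exp (Complex.I * (sympl x y : ℂ)) *
      ((starRingEnd ℂ) (g t) * weyl x g t)) y.pos]
  refine integral_congr_ae ?_
  have h1 := coeFn_weyl x (weyl y g)
  have h2 := weylFun_congr_ae x (coeFn_weyl y g)
  have h3 := (measurePreserving_sub_right volume y.pos).quasiMeasurePreserving.ae_eq_comp
    (coeFn_weyl x g)
  filter_upwards [h1, h2, h3, coeFn_weyl y g] with t h1 h2 h3 h4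
  simp only [Function.comp_apply] at h3
  rw [h1, h2, h3, h4, sympl_eq_inner]
  simp only [weylFun, map_mul, ← Complex.exp_conj, Complex.conj_I, Complex.conj_ofReal,
    sub_right_comm t y.pos x.pos, inner_sub_right]
  have : ∀ a b c A B G G' : ℂ, a + b + c = A + B →
      Complex.exp a * G * (Complex.exp b * (Complex.exp c * G')) =
      Complex.exp A * (G * (Complex.exp B * G')) := fun a b c A B G G' h => by
    have := congrArg Complex.exp h
    rw [Complex.exp_add, Complex.exp_add, Complex.exp_add] at this
    linear_combination G * G' * this
  refine this _ _ _ _ _ _ _ ?_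
  push_cast
  ring

/-- On a complex space an operator with vanishing quadratic form is zero, whereas `weyl x` is
isometric and the space contains a nonzero vector. -/
theorem exists_inner_weyl_ne_zero (x : PhaseSpace N) :
    ∃ g : ModeSpace N, inner ℂ g (weyl x g) ≠ 0 := by
  by_contra! h
  have h0 : (weyl x : ModeSpace N →ₗ[ℂ] ModeSpace N) = 0 := by
    rw [← inner_map_self_eq_zero]
    intro g
    rw [inner_eq_zero_symm]
    exact h g
  let s : Set (EuclideanSpace ℝ (Fin N)) := Metric.ball 0 1
  have hs : volume s ≠ ∞ := measure_ball_lt_top.ne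
  let g : ModeSpace N := indicatorConstLp 2 (measurableSet_ball : MeasurableSet s) hs 1
  have hg : ‖g‖ ≠ 0 := by
    rw [norm_indicatorConstLp (by simp) (by simp)]
    have : 0 < volume.real s := ENNReal.toReal_pos (Metric.measure_ball_pos _ _ one_pos).ne' hs
    rw [norm_one, one_mul]
    exact (Real.rpow_pos_of_pos this _).ne'
  have h1 : weyl x g = 0 := LinearMap.congr_fun h0 g
  rw [← norm_weyl_apply x g, h1, norm_zero] at hg
  exact hg rfl

end WeylRelations

/-! ### Even and odd subsets -/

section AlternatingSum

theorem sum_even_sub_sum_not_even {J : Type*} [Fintype J] [DecidableEq J] (z : J → ℂ) :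
    (∑ S : {S : Finset J // Even S.card}, ∏ j ∈ S.1, z j) -
      ∑ S : {S : Finset J // ¬ Even S.card}, ∏ j ∈ S.1, z j = ∏ j, (1 - z j) := by
  have h := Fintype.sum_subtype_add_sum_subtype (fun S : Finset J => Even S.card)
    (fun S => ∏ j ∈ S, -z j)
  have h1 : ∀ S : Finset J, ∏ j ∈ S, -z j = (-1) ^ S.card * ∏ j ∈ S, z j := fun S => by
    rw [Finset.prod_neg]
  simp_rw [sub_eq_add_neg, Finset.prod_one_add, Finset.powerset_univ, ← h, h1]
  rw [← Finset.sum_neg_distrib]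
  congr 1
  · exact Finset.sum_congr rfl fun S _ => by rw [S.2.neg_one_pow, one_mul]
  · exact Finset.sum_congr rfl fun S _ => by
      rw [(Nat.not_even_iff_odd.1 S.2).neg_one_pow, neg_one_mul]

/-- Setting every `z j = 1` makes the product vanish; nonemptiness excludes the empty product. -/
theorem card_even_eq_card_not_even {J : Type*} [Fintype J] [DecidableEq J] [Nonempty J] :
    Fintype.card {S : Finset J // Even S.card} = Fintype.card {S : Finset J // ¬ Even S.card} := by
  have h := sum_even_sub_sum_not_even (fun _ : J => 1)
  simp only [Finset.prod_const_one, Finset.sum_const, sub_self, Finset.prod_const,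
    Finset.card_univ, zero_pow Fintype.card_ne_zero, nsmul_eq_mul, mul_one, sub_eq_zero] at h
  exact_mod_cast h

end AlternatingSum

/-! ### Two states indistinguishable on finitely many proper subspaces -/

section Displaced

variable {N : ℕ}

/-- The normalized mixture of the vector `g` displaced by the phase space points `y i`. -/
noncomputable def displacedMixture {ι : Type*} [Fintype ι] (g : ModeSpace N)
    (y : ι → PhaseSpace N) : ModeSpace N →L[ℂ] ModeSpace N :=
  ∑ i, InnerProductSpace.rankOne ℂ
    ((((‖g‖ * √(Fintype.card ι))⁻¹ : ℝ) : ℂ) • weyl (y i) g)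
    ((((‖g‖ * √(Fintype.card ι))⁻¹ : ℝ) : ℂ) • weyl (y i) g)

variable {ι : Type*} [Fintype ι] (g : ModeSpace N) (y : ι → PhaseSpace N)

theorem isState_displacedMixture [Nonempty ι] (hg : g ≠ 0) : IsState (displacedMixture g y) := by
  refine (isDecomposition_sum_rankOne _).isState ?_
  have hg' : ‖g‖ ≠ 0 := norm_ne_zero_iff.2 hg
  have hc : (Fintype.card ι : ℝ) ≠ 0 := Nat.cast_ne_zero.2 Fintype.card_ne_zero
  simp only [norm_smul, norm_weyl_apply, tsum_fintype, Finset.sum_const, Finset.card_univ,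
    nsmul_eq_mul, Complex.norm_real, mul_pow, norm_inv, norm_mul, inv_pow, Real.norm_eq_abs, sq_abs,
    Real.sq_sqrt (Nat.cast_nonneg (Fintype.card ι)), abs_norm]
  field_simp

theorem trace_displacedMixture (x : PhaseSpace N) :
    trace (displacedMixture g y ∘L weyl x) =
      (((‖g‖ * √(Fintype.card ι))⁻¹ : ℝ) : ℂ) ^ 2 * inner ℂ g (weyl x g) *
        ∑ i, Complex.exp (Complex.I * (sympl x (y i) : ℂ)) := by
  rw [displacedMixture, (isDecomposition_sum_rankOne _).trace_comp, tsum_fintype, Finset.mul_sum]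
  refine Finset.sum_congr rfl fun i _ => ?_
  rw [map_smul, inner_smul_left, inner_smul_right, inner_weyl_conj, Complex.conj_ofReal]
  ring

/-- For finitely many proper subspaces of phase space there are two distinct states whose
characteristic functions agree on each of them. -/
theorem exists_isState_ne_of_ne_top {J : Type*} [Finite J] [Nonempty J]
    (K : J → Submodule ℝ (PhaseSpace N)) (hK : ∀ j, K j ≠ ⊤) :
    ∃ ρ σ : ModeSpace N →L[ℂ] ModeSpace N, IsState ρ ∧ IsState σ ∧ ρ ≠ σ ∧
      ∀ j, ∀ x ∈ K j, trace (ρ ∘L weyl x) = trace (σ ∘L weyl x) := by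
  classical
  have := Fintype.ofFinite J
  obtain ⟨x₀, hx₀⟩ : ∃ x₀, ∀ j, x₀ ∉ K j := by
    -- A real vector space is not a finite union of proper subspaces.
    by_contra! h
    obtain ⟨j, hj⟩ := Subspace.exists_eq_top_of_iUnion_eq_univ (p := K)
      (Set.eq_univ_of_forall fun x => Set.mem_iUnion.2 (h x))
    exact hK j hj
  -- A functional vanishing on `K j` but not at `x₀` is rescaled to take the value `π` there, so
  -- that `exp(iπ) = -1` and each factor at `x₀` equals `2`.
  have hy : ∀ j, ∃ y, sympl x₀ y = Real.pi ∧ ∀ x ∈ K j, sympl x y = 0 := fun j => by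
    obtain ⟨f, hf, hf'⟩ := Submodule.exists_dual_map_eq_bot_of_notMem (hx₀ j) inferInstance
    obtain ⟨y, hy⟩ := exists_sympl_eq ((Real.pi / f x₀) • f)
    refine ⟨y, ?_, fun x hx => ?_⟩
    · rw [hy, LinearMap.smul_apply, smul_eq_mul, div_mul_cancel₀ _ hf]
    · have : f x ∈ (K j).map f := Submodule.mem_map_of_mem hx
      rw [hf', Submodule.mem_bot] at this
      rw [hy, LinearMap.smul_apply, this, smul_zero]
  choose y hy hyK using hy
  obtain ⟨g, hg⟩ := exists_inner_weyl_ne_zero x₀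
  have hg0 : g ≠ 0 := fun h => hg (by simp [h])
  have hcard := card_even_eq_card_not_even (J := J)
  have : Nonempty {S : Finset J // Even S.card} := ⟨⟨∅, by simp⟩⟩
  have : Nonempty {S : Finset J // ¬ Even S.card} := by
    rw [← Fintype.card_pos_iff, ← hcard]
    exact Fintype.card_pos
  let ρ := displacedMixture g fun S : {S : Finset J // Even S.card} => ∑ j ∈ S.1, y j
  let σ := displacedMixture g fun S : {S : Finset J // ¬ Even S.card} => ∑ j ∈ S.1, y j
  let c : ℂ := ((‖g‖ * √(Fintype.card {S : Finset J // ¬ Even S.card}))⁻¹ : ℝ)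
  have hdiff : ∀ x, trace (ρ ∘L weyl x) - trace (σ ∘L weyl x) =
      c ^ 2 * inner ℂ g (weyl x g) *
        ∏ j, (1 - Complex.exp (Complex.I * (sympl x (y j) : ℂ))) := fun x => by
    -- Equal numbers of even and odd subsets give both mixtures the same normalization, so the
    -- difference is the alternating sum.
    simp only [ρ, σ, c, trace_displacedMixture, hcard, ← mul_sub]
    simp only [sympl_sum, Complex.ofReal_sum, Finset.mul_sum _ _ Complex.I, Complex.exp_sum,
      ← sum_even_sub_sum_not_even]
  refine ⟨ρ, σ, isState_displacedMixture g _ hg0, isState_displacedMixture g _ hg0, ?_, ?_⟩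
  · intro h
    have h1 := hdiff x₀
    rw [h, sub_self] at h1
    have hc : c ≠ 0 := by
      have : ‖g‖ ≠ 0 := norm_ne_zero_iff.2 hg0
      have : (Fintype.card {S : Finset J // ¬ Even S.card} : ℝ) ≠ 0 :=
        Nat.cast_ne_zero.2 Fintype.card_ne_zero
      simp only [c, ne_eq, Complex.ofReal_eq_zero, inv_eq_zero, mul_eq_zero, not_or]
      exact ⟨‹_›, by positivity⟩
    have h2 : ∏ j, (1 - Complex.exp (Complex.I * (sympl x₀ (y j) : ℂ))) ≠ 0 := by
      refine Finset.prod_ne_zero_iff.2 fun j _ => ?_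
      rw [hy, mul_comm, Complex.exp_pi_mul_I]
      norm_num
    exact mul_ne_zero (mul_ne_zero (pow_ne_zero 2 hc) hg) h2 h1.symm
  · intro j x hx
    rw [← sub_eq_zero, hdiff, Finset.prod_eq_zero (Finset.mem_univ j), mul_zero]
    simp [hyK j x hx]

end Displaced

/-! ### Gaussian observables and the finite case -/

section Gaussian

variable {N : ℕ}

/-- A Gaussian observable measures the characteristic function of a state on a subspace of phase
space. -/
theorem IsGaussian.exists_submodule {M : ℕ} {E : Observable (ModeSpace N) M} (hE : IsGaussian E) :
    ∃ K : Submodule ℝ (PhaseSpace N), ∀ ρ σ, IsState ρ → IsState σ →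
      ((∀ X, MeasurableSet X → E.prob ρ X = E.prob σ X) ↔
        ∀ x ∈ K, trace (ρ ∘L weyl x) = trace (σ ∘L weyl x)) := by
  obtain ⟨A, B, v, -, h⟩ := hE
  refine ⟨LinearMap.range A.mulVecLin, fun ρ σ hρ hσ => ?_⟩
  rw [E.prob_eq_iff hρ hσ (fun p => Complex.exp_ne_zero _) h]
  constructor
  · rintro h _ ⟨p, rfl⟩
    exact h (WithLp.toLp 2 p)
  · exact fun h p => h _ ⟨p.ofLp, rfl⟩

theorem informationallyComplete_iff_of_finite (hN : 0 < N) {I : Type*} [Finite I] {M : I → ℕ}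
    (E : (j : I) → Observable (ModeSpace N) (M j)) (hE : ∀ j, IsGaussian (E j)) :
    InformationallyComplete E ↔ ∃ j₀, InformationallyComplete fun _ : Unit => E j₀ := by
  constructor
  · intro h
    choose K hK using fun j => (hE j).exists_submodule
    by_contra! hI
    have htop : ∀ j, K j ≠ ⊤ := fun j hj => hI j fun ρ σ hρ hσ hprob =>
      hρ.ext_of_trace_weyl hσ fun x =>
        (hK j ρ σ hρ hσ).1 (hprob ()) x (hj ▸ Submodule.mem_top)
    have : Nontrivial (PhaseSpace N) :=
      have : Nonempty (Fin N × Fin 2) := ⟨(⟨0, hN⟩, 0)⟩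
      inferInstance
    -- Adjoining `⊥` keeps the index type nonempty even when `I` is empty; `⊥` is proper because `0
    -- < N`.
    obtain ⟨ρ, σ, hρ, hσ, hne, heq⟩ := exists_isState_ne_of_ne_top
      (fun j : Option I => j.elim ⊥ K) (by rintro (_ | j); exacts [bot_ne_top, htop j])
    exact hne (h ρ σ hρ hσ fun j => (hK j ρ σ hρ hσ).2 (heq (some j)))
  · rintro ⟨j₀, h⟩ ρ σ hρ hσ hprob
    exact h ρ σ hρ hσ fun _ => hprob j₀

end Gaussian

end GaussianObs

theorem mainTheorem2 {N : ℕ} (hN : 0 < N) {I : Type*} {M : I → ℕ}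
    (E : (j : I) → GaussianObs.Observable (GaussianObs.ModeSpace N) (M j)) (hE : ∀ j, GaussianObs.IsGaussian (E j)) :
    (Finite I →
      (GaussianObs.InformationallyComplete E ↔ ∃ j₀, GaussianObs.InformationallyComplete fun _ : Unit => E j₀)) ∧
    (GaussianObs.InformationallyComplete E → (∀ j, ¬ GaussianObs.InformationallyComplete fun _ : Unit => E j) →
      (Set.range fun j => (⟨M j, E j⟩ : Σ m, GaussianObs.Observable (GaussianObs.ModeSpace N) m)).Infinite) := by
  refine ⟨fun _ => GaussianObs.informationallyComplete_iff_of_finite hN E hE,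
    fun h hsingle hfin => ?_⟩
  have := hfin.to_subtype
  -- The finite case is applied to the set of distinct observables, indexed by itself: repetitions
  -- in `I` add no information.
  obtain ⟨⟨_, j, rfl⟩, hj⟩ := (GaussianObs.informationallyComplete_iff_of_finite hN
    (fun s : Set.range fun j =>
      (⟨M j, E j⟩ : Σ m, GaussianObs.Observable (GaussianObs.ModeSpace N) m) => s.1.2)
    (by rintro ⟨_, j, rfl⟩; exact hE j)).1
    (fun ρ σ hρ hσ hprob => h ρ σ hρ hσ fun j => hprob ⟨_, j, rfl⟩)
  exact hsingle j hj
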